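/- Theorem (Aoki). Let $G$ be a totally disconnected locally compact group, let $\mu$ be a left-invariant Haar measure on $G$, and let $f$ be an automorphism of $G$, i.e. a group automorphism that is a homeomorphism. Suppose that $f$ is ergodic with respect to $\mu$, meaning that every Borel set $E \subseteq G$ with $\mu(f^{-1}(E) \mathbin{\triangle} E) = 0$ satisfies $\mu(E) = 0$ or $\mu(G \setminus E) = 0$. Then $G$ is compact. -/

import Mathlib

open MeasureTheory

/-- A transformation `T` is ergodic relatively to a measure `μ` if every measurable set `E` with
`μ (T⁻¹ E ∆ E) = 0` satisfies `μ E = 0` or `μ Eᶜ = 0`.  (Invariance of `μ` under `T` is not part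
of this notion.) -/
def IsErgodicFor {X : Type*} [MeasurableSpace X] (T : X → X) (μ : Measure X) : Prop :=
  ∀ E : Set X, MeasurableSet E → μ (symmDiff (T ⁻¹' E) E) = 0 → μ E = 0 ∨ μ Eᶜ = 0

/-!
Let `α` be the automorphism and, for a compact open subgroup `V`, let `V₊` and `V₋` be the subgroups
of points whose backward, respectively forward, orbit lies in `V`. A discrete `G` is trivial, because
`{1}` is invariant and of positive measure; so let `G` be nondiscrete.

Two facts about `α` alone are used, both from Willis' theory of tidy subgroups. There is a compact
open `V` with `V = V₊ V₋` (`exists_eq_mul_staySubgroup`). For any compact open `V`, the homoclinic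
elements, those whose orbit lies in `V` at all but finitely many times, have a closure `L` that is a
compact `α`-invariant subgroup (`isCompact_closure_homoclinicSubgroup`). Consequently a point of `V`
that returns to `V` infinitely often lies in the compact set `C = V₋ L`
(`mem_mul_closure_homoclinicSubgroup`): if `x = m p` with `m ∈ V₋`, `p ∈ V₊` and `αⁿ x ∈ V`, then
`αⁿ p ∈ V` factors as `v r` with `v ∈ V₊` and `r ∈ V₋`, where `r` is homoclinic, so that `p` agrees
modulo `L` with the point `α⁻ⁿ v`, which stays in `V` up to time `n`. Letting `n → ∞` puts `p` in
`V₋ L`.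

Ergodicity enters through the fact that wandering subsets of compact sets are null
(`IsErgodicFor.measure_eq_zero_of_wandering`). Almost every point of `V` therefore returns to `V`
infinitely often, and since `C` is closed, `V ⊆ C`. As `αC ⊆ C` and the differences `αⁿC \ αⁿ⁺¹C` are
wandering, `⋂ n, αⁿC` is a compact invariant set of positive measure; its complement is open and null,
hence empty, and `G` is compact.
-/

open Set Filter Topology Pointwise

/-! ### Points whose orbit lies in a subgroup at prescribed times -/

section Stay
variable {G : Type*} [Group G]

/-- The elements whose orbit under `α` lies in `V` at all times `i ∈ S`. -/
def staySubgroup (α : MulAut G) (V : Subgroup G) (S : Set ℤ) : Subgroup G where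
  carrier := {x | ∀ i ∈ S, (α ^ i) x ∈ V}
  mul_mem' hx hy i hi := by rw [map_mul]; exact V.mul_mem (hx i hi) (hy i hi)
  one_mem' i _ := by rw [map_one]; exact V.one_mem
  inv_mem' hx i hi := by rw [map_inv]; exact V.inv_mem (hx i hi)

variable {α : MulAut G} {V : Subgroup G} {S T : Set ℤ} {x : G}

lemma mem_staySubgroup : x ∈ staySubgroup α V S ↔ ∀ i ∈ S, (α ^ i) x ∈ V := Iff.rfl

lemma staySubgroup_anti (h : S ⊆ T) : staySubgroup α V T ≤ staySubgroup α V S :=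
  fun _ hx i hi => hx i (h hi)

lemma zpow_zpow_apply (i j : ℤ) : (α ^ i) ((α ^ j) x) = (α ^ (i + j)) x := by
  rw [zpow_add, MulAut.mul_apply]

lemma zpow_mem_staySubgroup (k : ℤ) :
    (α ^ k) x ∈ staySubgroup α V S ↔ ∀ i ∈ S, (α ^ (i + k)) x ∈ V := by
  simp only [mem_staySubgroup, zpow_zpow_apply]

lemma staySubgroup_le (h : 0 ∈ S) : staySubgroup α V S ≤ V :=
  fun x hx => by simpa using hx 0 h

variable [TopologicalSpace G]

lemma isClosed_staySubgroup (hα : ∀ n : ℤ, Continuous (α ^ n)) (hV : IsClosed (V : Set G)) :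
    IsClosed (staySubgroup α V S : Set G) := by
  have : (staySubgroup α V S : Set G) = ⋂ i ∈ S, (α ^ i) ⁻¹' (V : Set G) := by
    ext x; simp [mem_staySubgroup]
  rw [this]
  exact isClosed_biInter fun i _ => hV.preimage (hα i)

lemma isOpen_staySubgroup (hα : ∀ n : ℤ, Continuous (α ^ n)) (hV : IsOpen (V : Set G))
    (hS : S.Finite) : IsOpen (staySubgroup α V S : Set G) := by
  have : (staySubgroup α V S : Set G) = ⋂ i ∈ S, (α ^ i) ⁻¹' (V : Set G) := by
    ext x; simp [mem_staySubgroup]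
  rw [this]
  exact hS.isOpen_biInter fun i _ => hV.preimage (hα i)

end Stay

/-- If for every member `S n` of a decreasing sequence of closed sets the condition `φ x ∈ S n` is
solvable in a compact set, then all these conditions are solvable simultaneously. -/
lemma IsCompact.exists_forall_mem_of_antitone {X Y : Type*} [TopologicalSpace X]
    [TopologicalSpace Y] {K : Set X} (hK : IsCompact K) {φ : X → Y} (hφ : Continuous φ)
    {S : ℕ → Set Y} (hS : Antitone S) (hc : ∀ n, IsClosed (S n))
    (h : ∀ n, ∃ x ∈ K, φ x ∈ S n) : ∃ x ∈ K, ∀ n, φ x ∈ S n := by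
  by_contra! hne
  obtain ⟨n, hn⟩ := hK.elim_directed_family_closed (fun n => φ ⁻¹' S n)
    (fun n => (hc n).preimage hφ)
    (by
      ext x
      simp only [mem_inter_iff, mem_iInter, mem_preimage, mem_empty_iff_false, iff_false, not_and]
      intro hx hall
      obtain ⟨n, hn⟩ := hne x hx
      exact hn (hall n))
    (directed_of_isDirected_le fun i j hij => preimage_mono (hS hij))
  obtain ⟨x, hx, hx'⟩ := h n
  exact (hn.subset ⟨hx, hx'⟩ : x ∈ (∅ : Set X))

/-! ### Compact open subgroups with a Willis factorization -/

section Tidy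
variable {G : Type*} [Group G] [TopologicalSpace G] [IsTopologicalGroup G]

/-- Van Dantzig's theorem. The subgroup is the stabilizer, under left translation, of a compact open
neighbourhood of `1`. -/
lemma exists_isOpen_isCompact_subgroup [LocallyCompactSpace G] [TotallyDisconnectedSpace G]
    {U : Set G} (hU : U ∈ 𝓝 (1 : G)) :
    ∃ V : Subgroup G, IsOpen (V : Set G) ∧ IsCompact (V : Set G) ∧ (V : Set G) ⊆ U := by
  obtain ⟨K, hK, hKU, hKc⟩ := local_compact_nhds hU
  obtain ⟨W, ⟨hWcl, hWo⟩, hW1, hWK⟩ :=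
    (loc_compact_Haus_tot_disc_of_zero_dim (H := G)).mem_nhds_iff.1 hK
  have hWc : IsCompact W := hKc.of_isClosed_subset hWcl hWK
  obtain ⟨N, hN, hNW⟩ := compact_open_separated_mul_left hWc hWo subset_rfl
  have hsub : ((MulAction.stabilizer G W : Subgroup G) : Set G) ⊆ W := fun g hg => by
    have h : g • W = W := hg
    rw [← h]
    exact ⟨1, hW1, by simp⟩
  have ho : IsOpen ((MulAction.stabilizer G W : Subgroup G) : Set G) := by
    refine Subgroup.isOpen_of_mem_nhds (g := 1) _
      (mem_of_superset (inter_mem hN (inv_mem_nhds_one G hN)) ?_)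
    rintro g ⟨hg, hg'⟩
    refine subset_antisymm ?_ ?_
    · rintro _ ⟨w, hw, rfl⟩
      exact hNW (mul_mem_mul hg hw)
    · intro w hw
      exact ⟨g⁻¹ * w, hNW (mul_mem_mul hg' hw), by simp⟩
  exact ⟨_, ho, hWc.of_isClosed_subset (Subgroup.isClosed_of_isOpen _ ho) hsub,
    hsub.trans (hWK.trans hKU)⟩

variable {α : MulAut G} {V : Subgroup G}

/-- Existence of a compact open subgroup `W` which is tidy above, i.e. `W = W₊ W₋` where `W₊` and
`W₋` consist of the points whose backward, respectively forward, orbit lies in `W`. Any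
`V ∩ αV ∩ ⋯ ∩ αⁿV` with `n` large is such a `W`. -/
lemma exists_eq_mul_staySubgroup [T2Space G] (hα : ∀ n : ℤ, Continuous (α ^ n))
    (hVo : IsOpen (V : Set G)) (hVc : IsCompact (V : Set G)) :
    ∃ W : Subgroup G, IsOpen (W : Set G) ∧ IsCompact (W : Set G) ∧
      ∀ w ∈ W, ∃ u ∈ staySubgroup α W (Iic 0), u⁻¹ * w ∈ staySubgroup α W (Ici 0) := by
  have hVcl := hVc.isClosed
  have hcl : ∀ S, IsClosed (staySubgroup α V S : Set G) := fun S => isClosed_staySubgroup hα hVcl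
  have hcp : ∀ S : Set ℤ, 0 ∈ S → IsCompact (staySubgroup α V S : Set G) := fun S hS =>
    hVc.of_isClosed_subset (hcl S) (staySubgroup_le hS)
  -- The compact sets `V ∩ ⋯ ∩ αⁿV` decrease to `V₊`, so one of them lies in the open
  -- neighbourhood `V₊ α⁻¹V` of `V₊`.
  obtain ⟨n, hn⟩ : ∃ n : ℕ, (staySubgroup α V (Icc (-(n : ℤ)) 0) : Set G) ⊆
      (staySubgroup α V (Iic 0) : Set G) * (α ^ (1 : ℤ)) ⁻¹' (V : Set G) := by
    refine exists_subset_nhds_of_isCompact (V := fun n : ℕ =>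
      (staySubgroup α V (Icc (-(n : ℤ)) 0) : Set G)) ?_ (fun n => hcp _ (by simp)) ?_
    · exact directed_of_isDirected_le fun i j hij => staySubgroup_anti
        (Icc_subset_Icc_left (by omega))
    · intro x hx
      refine ((hVo.preimage (hα 1)).mul_left).mem_nhds ?_
      refine ⟨x, fun i hi => ?_, 1, by simp [V.one_mem], mul_one x⟩
      exact mem_iInter.1 hx i.natAbs i ⟨by omega, hi⟩
  set W := staySubgroup α V (Icc (-(n : ℤ)) 0) with hW
  have hWc : IsCompact (W : Set G) := hcp _ (by simp)
  have hplus : staySubgroup α V (Iic 0) ≤ staySubgroup α W (Iic 0) := fun x hx i hi => by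
    rw [hW, zpow_mem_staySubgroup]
    exact fun j hj => hx _ (by simp only [mem_Iic, mem_Icc] at *; omega)
  -- One step of the factorization: `W ⊆ W₊ (W ∩ α⁻¹ W)`.
  have hstep : ∀ w ∈ W, ∃ u ∈ staySubgroup α W (Iic 0), u⁻¹ * w ∈ W ∧
      (α ^ (1 : ℤ)) (u⁻¹ * w) ∈ W := by
    intro w hw
    obtain ⟨u, hu, v, hv, rfl⟩ := hn hw
    have huW : u ∈ W := staySubgroup_anti Icc_subset_Iic_self hu
    have hvW : v ∈ W := by simpa using W.mul_mem (W.inv_mem huW) hw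
    refine ⟨u, hplus hu, by simpa using hvW, ?_⟩
    rw [inv_mul_cancel_left, hW, zpow_mem_staySubgroup]
    intro i hi
    rcases eq_or_ne i 0 with rfl | h0
    · simpa using hv
    · exact hvW _ (by simp only [mem_Icc] at *; omega)
  -- Applying the step to the `W ∩ α⁻¹ W` factor repeatedly gives `W ⊆ W₊ (W ∩ ⋯ ∩ α⁻ᵏ W)`.
  have hiter : ∀ k : ℕ, ∀ w ∈ W, ∃ u ∈ staySubgroup α W (Iic 0),
      u⁻¹ * w ∈ staySubgroup α W (Icc 0 (k : ℤ)) := by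
    intro k
    induction k with
    | zero =>
      intro w hw
      refine ⟨1, Subgroup.one_mem _, fun i hi => ?_⟩
      obtain rfl : i = 0 := by simp only [mem_Icc] at hi; omega
      simpa using hw
    | succ k ih =>
      intro w hw
      obtain ⟨u, hu, hv, hv'⟩ := hstep w hw
      obtain ⟨u', hu', hv2⟩ := ih _ hv'
      have hu'' : (α ^ (-1 : ℤ)) u' ∈ staySubgroup α W (Iic 0) :=
        (zpow_mem_staySubgroup _).2 fun i hi => hu' _ (by simp only [mem_Iic] at *; omega)
      refine ⟨u * (α ^ (-1 : ℤ)) u', Subgroup.mul_mem _ hu hu'', fun i hi => ?_⟩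
      have he : (u * (α ^ (-1 : ℤ)) u')⁻¹ * w =
          (α ^ (-1 : ℤ)) (u'⁻¹ * (α ^ (1 : ℤ)) (u⁻¹ * w)) := by
        rw [map_mul, zpow_zpow_apply, map_inv]
        simp [mul_assoc]
      rcases eq_or_ne i 0 with rfl | h0
      · rw [mul_inv_rev, mul_assoc]
        simpa using W.mul_mem (W.inv_mem (staySubgroup_le (by simp) hu'')) hv
      · rw [he, zpow_zpow_apply]
        exact hv2 _ (by simp only [mem_Icc] at *; push_cast at hi; omega)
  refine ⟨W, isOpen_staySubgroup hα hVo (finite_Icc _ _), hWc, fun w hw => ?_⟩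
  obtain ⟨u, hu, h⟩ := IsCompact.exists_forall_mem_of_antitone
    (hWc.of_isClosed_subset (isClosed_staySubgroup hα hWc.isClosed)
      (staySubgroup_le (S := Iic 0) (by simp)))
    (φ := fun u => u⁻¹ * w) (by fun_prop)
    (S := fun k : ℕ => (staySubgroup α W (Icc 0 (k : ℤ)) : Set G))
    (fun i j hij => staySubgroup_anti (Icc_subset_Icc_right (by omega)))
    (fun k => isClosed_staySubgroup hα hWc.isClosed) (fun k => hiter k w hw)
  exact ⟨u, hu, fun i hi => h i.natAbs i ⟨hi, by omega⟩⟩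

end Tidy

/-! ### The homoclinic subgroup and recurrent points -/

section Homoclinic
variable {G : Type*} [Group G]

/-- The elements whose orbit under `α` lies in `V` at all but finitely many times. -/
def homoclinicSubgroup (α : MulAut G) (V : Subgroup G) : Subgroup G where
  carrier := {x | ∃ N : ℕ, ∀ i : ℤ, N ≤ i.natAbs → (α ^ i) x ∈ V}
  mul_mem' := by
    rintro x y ⟨N, hN⟩ ⟨M, hM⟩
    refine ⟨max N M, fun i hi => ?_⟩
    rw [map_mul]
    exact V.mul_mem (hN i (le_of_max_le_left hi)) (hM i (le_of_max_le_right hi))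
  one_mem' := ⟨0, fun i _ => by rw [map_one]; exact V.one_mem⟩
  inv_mem' := by
    rintro x ⟨N, hN⟩
    exact ⟨N, fun i hi => by rw [map_inv]; exact V.inv_mem (hN i hi)⟩

variable {α : MulAut G} {V : Subgroup G} {x : G}

lemma zpow_mem_homoclinicSubgroup (k : ℤ) (hx : x ∈ homoclinicSubgroup α V) :
    (α ^ k) x ∈ homoclinicSubgroup α V := by
  obtain ⟨N, hN⟩ := hx
  refine ⟨N + k.natAbs, fun i hi => ?_⟩
  rw [zpow_zpow_apply]
  exact hN _ (by omega)

variable [TopologicalSpace G] [IsTopologicalGroup G]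

/-- The homoclinic subgroup is relatively compact. Its subgroup `H` of elements with backward orbit
in `V` satisfies `αH ⊆ X H` with `X ⊆ αH` finite, because `αV` meets finitely many cosets of `V`.
From some time `M` on, the forward orbits of all elements of `X` stay in `V`, so that passing from
`α ^ (M + k) H` to `α ^ (M + k + 1) H` only adds a factor in `V₋`. -/
lemma homoclinicSubgroup_subset (hα : ∀ n : ℤ, Continuous (α ^ n))
    (hVo : IsOpen (V : Set G)) (hVc : IsCompact (V : Set G)) :
    ∃ M : ℕ, (homoclinicSubgroup α V : Set G) ⊆
      (staySubgroup α V (Ici 0) : Set G) * ((α ^ (M : ℤ)) '' (V : Set G)) := by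
  set H : Subgroup G := homoclinicSubgroup α V ⊓ staySubgroup α V (Iic 0) with hH
  have hQ : ((QuotientGroup.mk : G → G ⧸ V) '' ((α ^ (1 : ℤ)) '' (H : Set G))).Finite := by
    have : DiscreteTopology (G ⧸ V) := QuotientGroup.discreteTopology hVo
    refine ((hVc.image (hα 1)).image QuotientGroup.continuous_mk).finite_of_discrete.subset ?_
    exact image_mono (image_mono fun x hx => staySubgroup_le (S := Iic 0) (by simp) hx.2)
  obtain ⟨M, hM⟩ : ∃ M : ℕ, ∀ y ∈ H, ∃ z ∈ H, ((α ^ (1 : ℤ)) z)⁻¹ * (α ^ (1 : ℤ)) y ∈ V ∧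
      ∀ i : ℤ, M ≤ i.natAbs → (α ^ i) ((α ^ (1 : ℤ)) z) ∈ V := by
    have hrep : ∀ q ∈ (QuotientGroup.mk : G → G ⧸ V) '' ((α ^ (1 : ℤ)) '' (H : Set G)),
        ∃ N : ℕ, ∃ z ∈ H, QuotientGroup.mk ((α ^ (1 : ℤ)) z) = q ∧
          ∀ i : ℤ, N ≤ i.natAbs → (α ^ i) ((α ^ (1 : ℤ)) z) ∈ V := by
      rintro _ ⟨_, ⟨z, hz, rfl⟩, rfl⟩
      obtain ⟨N, hN⟩ := zpow_mem_homoclinicSubgroup 1 hz.1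
      exact ⟨N, z, hz, rfl, hN⟩
    choose! N hN using hrep
    obtain ⟨M, hM⟩ := (hQ.image N).bddAbove
    refine ⟨M, fun y hy => ?_⟩
    have hq := mem_image_of_mem (QuotientGroup.mk : G → G ⧸ V)
      (mem_image_of_mem (α ^ (1 : ℤ)) (show y ∈ (H : Set G) from hy))
    obtain ⟨z, hz, hzq, hzV⟩ := hN _ hq
    exact ⟨z, hz, QuotientGroup.eq.1 hzq,
      fun i hi => hzV i ((hM (mem_image_of_mem N hq)).trans hi)⟩
  -- `α ^ (M + k) H ⊆ V₋ (α ^ M V)` for all `k`.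
  have hstep : ∀ k : ℕ, ∀ y ∈ H, (α ^ ((M : ℤ) + k)) y ∈
      (staySubgroup α V (Ici 0) : Set G) * ((α ^ (M : ℤ)) '' (V : Set G)) := by
    intro k
    induction k with
    | zero =>
      intro y hy
      refine ⟨1, Subgroup.one_mem _, _, mem_image_of_mem _
        (staySubgroup_le (S := Iic 0) (by simp) hy.2), ?_⟩
      simp
    | succ k ih =>
      intro y hy
      obtain ⟨z, hz, hzy, hzM⟩ := hM y hy
      -- The factor `v = (αz)⁻¹ (αy)` is again in `H`, as `αV₊ ∩ V = V₊`.
      have hv : ((α ^ (1 : ℤ)) z)⁻¹ * (α ^ (1 : ℤ)) y ∈ H := by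
        refine ⟨Subgroup.mul_mem _ (Subgroup.inv_mem _ (zpow_mem_homoclinicSubgroup _ hz.1))
          (zpow_mem_homoclinicSubgroup _ hy.1), fun i hi => ?_⟩
        rcases eq_or_ne i 0 with rfl | h0
        · simpa using hzy
        · have hi1 : i + 1 ∈ Iic (0 : ℤ) := by simp only [mem_Iic] at *; omega
          rw [map_mul, map_inv, zpow_zpow_apply, zpow_zpow_apply]
          exact V.mul_mem (V.inv_mem (hz.2 _ hi1)) (hy.2 _ hi1)
      obtain ⟨b, hb, c, hc, hbc⟩ := ih _ hv
      refine ⟨(α ^ ((M : ℤ) + k)) ((α ^ (1 : ℤ)) z) * b, Subgroup.mul_mem _ (fun i hi => ?_) hb,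
        c, hc, ?_⟩
      · rw [zpow_zpow_apply]
        exact hzM _ (by simp only [mem_Ici] at hi; omega)
      · simp only at hbc ⊢
        rw [mul_assoc, hbc, ← map_mul, mul_inv_cancel_left, zpow_zpow_apply]
        push_cast
        rw [add_assoc]
  -- Every homoclinic element lies in `α ^ (M + N) H` for some `N`.
  refine ⟨M, fun h hh => ?_⟩
  obtain ⟨N, hN⟩ := id hh
  have hy : (α ^ (-((M : ℤ) + N))) h ∈ H :=
    ⟨zpow_mem_homoclinicSubgroup _ hh, (zpow_mem_staySubgroup _).2 fun i hi =>
      hN _ (by simp only [mem_Iic] at hi; omega)⟩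
  simpa [zpow_zpow_apply] using hstep N _ hy

lemma zpow_mem_topologicalClosure_homoclinicSubgroup (hα : ∀ n : ℤ, Continuous (α ^ n)) (k : ℤ)
    (hx : x ∈ (homoclinicSubgroup α V).topologicalClosure) :
    (α ^ k) x ∈ (homoclinicSubgroup α V).topologicalClosure :=
  map_mem_closure (hα k) hx fun _ => zpow_mem_homoclinicSubgroup k

variable [T2Space G]

lemma isCompact_closure_homoclinicSubgroup (hα : ∀ n : ℤ, Continuous (α ^ n))
    (hVo : IsOpen (V : Set G)) (hVc : IsCompact (V : Set G)) :
    IsCompact ((homoclinicSubgroup α V).topologicalClosure : Set G) := by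
  obtain ⟨M, hM⟩ := homoclinicSubgroup_subset hα hVo hVc
  have hK : IsCompact ((staySubgroup α V (Ici 0) : Set G) * ((α ^ (M : ℤ)) '' (V : Set G))) :=
    (hVc.of_isClosed_subset (isClosed_staySubgroup hα hVc.isClosed)
      (staySubgroup_le (by simp))).mul (hVc.image (hα M))
  exact hK.of_isClosed_subset (Subgroup.isClosed_topologicalClosure _)
    (closure_minimal hM hK.isClosed)

/-- A point of `V = V₋ V₊` that returns to `V` at arbitrarily large times lies in `V₋ L`, where `L` is
the closure of the homoclinic subgroup. -/
lemma mem_mul_closure_homoclinicSubgroup (hα : ∀ n : ℤ, Continuous (α ^ n))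
    (hVo : IsOpen (V : Set G)) (hVc : IsCompact (V : Set G))
    (hfac : ∀ w ∈ V, ∃ u ∈ staySubgroup α V (Iic 0), u⁻¹ * w ∈ staySubgroup α V (Ici 0))
    (hx : x ∈ V) (hrec : ∀ N : ℕ, ∃ n : ℕ, N ≤ n ∧ (α ^ (n : ℤ)) x ∈ V) :
    x ∈ (staySubgroup α V (Ici 0) : Set G) *
      ((homoclinicSubgroup α V).topologicalClosure : Set G) := by
  -- Factoring `x⁻¹` instead of `x` gives `x = (x u) u⁻¹` with `x u ∈ V₋` and `u⁻¹ ∈ V₊`.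
  obtain ⟨u, hu, hm⟩ := hfac _ (V.inv_mem hx)
  have hm : x * u ∈ staySubgroup α V (Ici 0) := by simpa using Subgroup.inv_mem _ hm
  -- Modulo `L`, the factor `u⁻¹` stays in `V` up to any given time, hence forever by compactness.
  have hex : ∀ N : ℕ, ∃ l ∈ ((homoclinicSubgroup α V).topologicalClosure : Set G),
      u⁻¹ * l ∈ (staySubgroup α V (Iic (N : ℤ)) : Set G) := by
    intro N
    obtain ⟨n, hn, hnx⟩ := hrec N
    have hp : (α ^ (n : ℤ)) u⁻¹ ∈ V := by
      have := V.mul_mem (V.inv_mem (hm n (by simp))) hnx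
      simpa [mul_assoc] using this
    -- `αⁿ u⁻¹ = v r` with `v ∈ V₊`, `r ∈ V₋`. Both `αⁿ u⁻¹` and `v` have a backward orbit
    -- eventually in `V`, so `r` is homoclinic.
    obtain ⟨v, hv, hr⟩ := hfac _ hp
    have hrH : v⁻¹ * (α ^ (n : ℤ)) u⁻¹ ∈ homoclinicSubgroup α V := by
      refine ⟨n, fun i hi => ?_⟩
      rcases le_total 0 i with h0 | h0
      · exact hr i h0
      · rw [map_mul, map_inv, zpow_zpow_apply]
        refine V.mul_mem (V.inv_mem (hv i h0)) ?_
        rw [map_inv]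
        exact V.inv_mem (hu _ (by simp only [mem_Iic]; omega))
    refine ⟨((α ^ (-(n : ℤ))) (v⁻¹ * (α ^ (n : ℤ)) u⁻¹))⁻¹, subset_closure
      (Subgroup.inv_mem _ (zpow_mem_homoclinicSubgroup _ hrH)), ?_⟩
    have he : u⁻¹ * ((α ^ (-(n : ℤ))) (v⁻¹ * (α ^ (n : ℤ)) u⁻¹))⁻¹ = (α ^ (-(n : ℤ))) v := by
      rw [map_mul, zpow_zpow_apply]
      simp
    rw [he]
    exact (zpow_mem_staySubgroup _).2 fun i hi =>
      hv _ (by simp only [mem_Iic] at *; omega)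
  obtain ⟨l, hl, h⟩ := IsCompact.exists_forall_mem_of_antitone
    (isCompact_closure_homoclinicSubgroup hα hVo hVc) (φ := fun l => u⁻¹ * l) (by fun_prop)
    (S := fun N : ℕ => (staySubgroup α V (Iic (N : ℤ)) : Set G))
    (fun i j hij => staySubgroup_anti (Iic_subset_Iic.2 (by omega)))
    (fun k => isClosed_staySubgroup hα hVc.isClosed) hex
  refine ⟨x * u * (u⁻¹ * l), Subgroup.mul_mem _ hm fun i _ =>
    h i.natAbs i (by simp only [mem_Iic]; omega), l⁻¹, Subgroup.inv_mem _ hl, by simp [mul_assoc]⟩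

end Homoclinic

/-! ### Ergodic automorphisms and wandering sets -/

lemma IsErgodicFor.compactSpace_of_invariant {G : Type*} [TopologicalSpace G]
    [MeasurableSpace G] [BorelSpace G] {μ : Measure G} [μ.IsOpenPosMeasure] {α : G → G}
    (hf : IsErgodicFor α μ) {E : Set G} (hEc : IsCompact E)
    (hEcl : IsClosed E) (hinv : α ⁻¹' E = E) (hE : μ E ≠ 0) :
    CompactSpace G := by
  have h0 := (hf E hEcl.measurableSet (by rw [hinv]; simp)).resolve_left hE
  rw [hEcl.isOpen_compl.measure_eq_zero_iff μ, compl_empty_iff] at h0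
  exact ⟨h0 ▸ hEc⟩

section Ergodic
variable {G : Type*} [Group G] [TopologicalSpace G] [IsTopologicalGroup G]
  [MeasurableSpace G] [BorelSpace G] {μ : Measure G} [μ.IsHaarMeasure] {α : MulAut G}

/-- In a nondiscrete group every open subgroup contains an open subgroup of index at least two, so
open subgroups have arbitrarily small measure. This replaces outer regularity, which is not part of
`IsHaarMeasure`. -/
lemma exists_subgroup_measure_lt [LocallyCompactSpace G] [TotallyDisconnectedSpace G]
    (hd : ¬ DiscreteTopology G) {ε : ENNReal} (hε : ε ≠ 0) :
    ∃ U : Subgroup G, IsOpen (U : Set G) ∧ μ U < ε := by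
  obtain ⟨V, hVo, hVc, -⟩ := exists_isOpen_isCompact_subgroup (G := G) univ_mem
  have key : ∀ n : ℕ, ∃ U : Subgroup G, IsOpen (U : Set G) ∧ 2 ^ n * μ U ≤ μ V := by
    intro n
    induction n with
    | zero => exact ⟨V, hVo, by simp⟩
    | succ n ih =>
      obtain ⟨U, hUo, hU⟩ := ih
      obtain ⟨x, hxU, hx1⟩ : ∃ x ∈ U, x ≠ 1 := by
        by_contra! h
        refine hd (discreteTopology_of_isOpen_singleton_one ?_)
        convert hUo
        exact (subset_antisymm h (by simp [U.one_mem])).symm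
      obtain ⟨W, hWo, -, hWU⟩ := exists_isOpen_isCompact_subgroup (G := G)
        (U := (U : Set G) ∩ {x}ᶜ)
        ((hUo.inter isOpen_compl_singleton).mem_nhds ⟨U.one_mem, hx1.symm⟩)
      refine ⟨W, hWo, le_trans ?_ hU⟩
      have hdisj : Disjoint (W : Set G) (x • (W : Set G)) := by
        rw [disjoint_left]
        rintro _ hy ⟨w, hw, rfl⟩
        have : x ∈ W := by simpa using W.mul_mem hy (W.inv_mem hw)
        exact (hWU this).2 rfl
      have hsub : (W : Set G) ∪ x • (W : Set G) ⊆ U := by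
        refine union_subset (fun w hw => (hWU hw).1) ?_
        rintro _ ⟨w, hw, rfl⟩
        exact U.mul_mem hxU (hWU hw).1
      have h2 : 2 * μ W ≤ μ U := by
        have := measure_mono (μ := μ) hsub
        rwa [measure_union hdisj (hWo.smul x).measurableSet, measure_smul, ← two_mul] at this
      rw [pow_succ, mul_assoc]
      gcongr
  obtain ⟨n, hn⟩ := ENNReal.exists_nat_mul_gt hε (hVc.measure_lt_top (μ := μ)).ne
  obtain ⟨U, hUo, hU⟩ := key n
  refine ⟨U, hUo, ?_⟩
  have : 2 ^ n * μ U < 2 ^ n * ε := hU.trans_lt (hn.trans_le (by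
    gcongr
    exact_mod_cast Nat.lt_two_pow_self.le))
  exact lt_of_mul_lt_mul_left' this

/-- A wandering set of positive measure contains a piece `B` of positive measure whose complement in
it also has positive measure; the union of the translates of `B` under powers of `α` is then an
invariant set violating ergodicity. -/
lemma IsErgodicFor.measure_eq_zero_of_wandering [LocallyCompactSpace G]
    [TotallyDisconnectedSpace G] (hα : ∀ n : ℤ, Continuous (α ^ n)) (hf : IsErgodicFor α μ)
    (hd : ¬ DiscreteTopology G) {K A : Set G} (hK : IsCompact K) (hA : MeasurableSet A)
    (hAK : A ⊆ K) (hw : ∀ x ∈ A, ∀ n : ℤ, 0 < n → (α ^ n) x ∉ A) : μ A = 0 := by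
  by_contra hne
  obtain ⟨U, hUo, hU⟩ := exists_subgroup_measure_lt (μ := μ) hd hne
  obtain ⟨t, ht⟩ := hK.elim_finite_subcover (fun g : G => g • (U : Set G)) (fun g => hUo.smul g)
    (fun x _ => mem_iUnion.2 ⟨x, 1, U.one_mem, by simp⟩)
  obtain ⟨g, hg⟩ : ∃ g : G, μ (A ∩ g • (U : Set G)) ≠ 0 := by
    by_contra! h
    refine hne (measure_mono_null (t := ⋃ g ∈ t, A ∩ g • (U : Set G)) ?_ ?_)
    · rw [← inter_iUnion₂]
      exact subset_inter subset_rfl (hAK.trans ht)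
    · exact (measure_biUnion_null_iff t.countable_toSet).2 fun g _ => h g
  set B := A ∩ g • (U : Set G) with hB
  have hBm : MeasurableSet B := hA.inter (hUo.smul g).measurableSet
  have hBA : μ B < μ A := by
    refine lt_of_le_of_lt ?_ hU
    rw [← measure_smul (μ := μ) g (U : Set G)]
    exact measure_mono inter_subset_right
  have hEm : MeasurableSet (⋃ i : ℤ, (α ^ i) ⁻¹' B) :=
    MeasurableSet.iUnion fun i => (hα i).measurable hBm
  have hEi : α ⁻¹' (⋃ i : ℤ, (α ^ i) ⁻¹' B) = ⋃ i : ℤ, (α ^ i) ⁻¹' B := by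
    ext x
    simp only [mem_preimage, mem_iUnion]
    have h1 : ∀ i : ℤ, (α ^ i) (α x) = (α ^ (i + 1)) x := fun i => by
      rw [← zpow_zpow_apply, zpow_one]
    constructor
    · rintro ⟨i, hi⟩
      exact ⟨i + 1, by rwa [← h1]⟩
    · rintro ⟨i, hi⟩
      exact ⟨i - 1, by rwa [h1, sub_add_cancel]⟩
  rcases hf _ hEm (by rw [hEi]; simp) with h | h
  · exact hg (measure_mono_null (fun x hx => mem_iUnion.2 ⟨0, by simpa using hx⟩) h)
  · have hAB : μ (A \ B) = 0 := by
      refine measure_mono_null (t := (⋃ i : ℤ, (α ^ i) ⁻¹' B)ᶜ) (fun x hx hxE => ?_) h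
      obtain ⟨i, hi⟩ := mem_iUnion.1 hxE
      rcases lt_trichotomy i 0 with h0 | rfl | h0
      · refine hw _ (inter_subset_left hi) (-i) (by omega) ?_
        rw [zpow_zpow_apply]
        simpa using hx.1
      · exact hx.2 (by simpa using hi)
      · exact hw x hx.1 i h0 (inter_subset_left hi)
    have := measure_le_inter_add_sdiff μ A B
    rw [hAB, add_zero] at this
    exact absurd (this.trans (measure_mono inter_subset_right)) hBA.not_ge

variable [LocallyCompactSpace G] [TotallyDisconnectedSpace G]

/-- A closed set containing all points of the compact open set `V` that return to `V` at arbitrarily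
large times contains `V`: the points of `V` visiting `V` for the last time at time `n` form a
wandering set, hence a null set. -/
lemma IsErgodicFor.subset_of_recurrent (hα : ∀ n : ℤ, Continuous (α ^ n))
    (hf : IsErgodicFor α μ) (hd : ¬ DiscreteTopology G) {V C : Set G} (hVo : IsOpen V)
    (hVc : IsCompact V) (hC : IsClosed C)
    (h : ∀ x ∈ V, (∀ N : ℕ, ∃ n : ℕ, N ≤ n ∧ (α ^ (n : ℤ)) x ∈ V) → x ∈ C) : V ⊆ C := by
  let A : ℕ → Set G := fun n =>
    V ∩ ((α ^ (n : ℤ)) ⁻¹' V ∩ ⋂ m : ℕ, (α ^ ((n : ℤ) + m + 1)) ⁻¹' Vᶜ)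
  have hVm := hVo.measurableSet
  have hA0 : ∀ n, μ (A n) = 0 := fun n => by
    refine hf.measure_eq_zero_of_wandering hα hd hVc ?_ inter_subset_left ?_
    · exact hVm.inter (((hα _).measurable hVm).inter
        (MeasurableSet.iInter fun m => (hα _).measurable hVm.compl))
    · rintro x ⟨-, -, hx⟩ k hk ⟨-, hy, -⟩
      have := mem_iInter.1 hx (k.toNat - 1)
      refine this ?_
      rw [mem_preimage, zpow_zpow_apply] at hy
      convert hy using 3
      omega
  have hsub : V \ C ⊆ ⋃ n, A n := by
    rintro x ⟨hxV, hxC⟩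
    classical
    have hex : ∃ N : ℕ, ∀ n : ℕ, N ≤ n → (α ^ (n : ℤ)) x ∉ V := by
      by_contra! hcon
      exact hxC (h x hxV hcon)
    obtain ⟨N, hN, hmin⟩ : ∃ N : ℕ, (∀ n : ℕ, N ≤ n → (α ^ (n : ℤ)) x ∉ V) ∧
        ∀ M < N, ¬ ∀ n : ℕ, M ≤ n → (α ^ (n : ℤ)) x ∉ V :=
      ⟨Nat.find hex, Nat.find_spec hex, fun M hM => Nat.find_min hex hM⟩
    obtain _ | N := N
    · exact absurd (by simpa using hxV) (hN 0 le_rfl)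
    have hlast := hmin N (Nat.lt_succ_self N)
    push Not at hlast
    obtain ⟨n, hn, hnV⟩ := hlast
    obtain rfl : n = N := by
      by_contra hne
      exact hN n (by omega) hnV
    refine mem_iUnion.2 ⟨n, hxV, hnV, mem_iInter.2 fun m => ?_⟩
    exact_mod_cast hN (n + m + 1) (by omega)
  have h0 := measure_mono_null hsub (measure_iUnion_null hA0)
  rw [(hVo.sdiff hC).measure_eq_zero_iff μ] at h0
  exact sdiff_eq_empty.1 h0

/-- If a compact set `C` with `αC ⊆ C` contains a nonempty compact open set `V`, then
`E = ⋂ n, αⁿC` is compact, invariant and of positive measure: the parts `V ∩ (αⁿC \ αⁿ⁺¹C)` of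
`V \ E` are wandering. -/
lemma IsErgodicFor.compactSpace_of_mapsTo (hα : ∀ n : ℤ, Continuous (α ^ n))
    (hf : IsErgodicFor α μ) (hd : ¬ DiscreteTopology G) {V C : Set G} (hVo : IsOpen V)
    (hVne : V.Nonempty) (hVc : IsCompact V) (hC : IsCompact C) (hCα : MapsTo α C C)
    (hVC : V ⊆ C) : CompactSpace G := by
  have h1 : ∀ (i : ℤ) (x : G), (α ^ i) (α x) = (α ^ (i + 1)) x := fun i x => by
    rw [← zpow_zpow_apply, zpow_one]
  have h1' : ∀ (i : ℤ) (x : G), α ((α ^ i) x) = (α ^ (i + 1)) x := fun i x => by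
    rw [add_comm, ← zpow_zpow_apply, zpow_one]
  have hCcl := hC.isClosed
  set E : Set G := ⋂ n : ℕ, (α ^ (-(n : ℤ))) ⁻¹' C with hE
  have hEcl : IsClosed E := isClosed_iInter fun n => hCcl.preimage (hα _)
  have hEC : E ⊆ C := fun x hx => by simpa using mem_iInter.1 hx 0
  have hinv : α ⁻¹' E = E := by
    ext x
    simp only [hE, mem_preimage, mem_iInter, h1]
    constructor
    · intro h n
      convert h (n + 1) using 3
      push_cast; ring
    · rintro h (_ | n)
      · have := hCα (h 0)
        rw [h1'] at this
        exact this
      · convert h n using 3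
        push_cast; ring
  let A : ℕ → Set G := fun n =>
    V ∩ ((α ^ (-(n : ℤ))) ⁻¹' C ∩ (α ^ (-(n : ℤ) - 1)) ⁻¹' Cᶜ)
  have hmaps : ∀ (k : ℕ) (i : ℤ) (x : G), (α ^ i) x ∈ C → (α ^ (i + k)) x ∈ C := by
    intro k
    induction k with
    | zero => intro i x hx; simpa using hx
    | succ k ih =>
      intro i x hx
      have := hCα (ih i x hx)
      rw [h1'] at this
      rwa [Nat.cast_succ, ← add_assoc]
  have hA0 : ∀ n, μ (A n) = 0 := fun n => by
    refine hf.measure_eq_zero_of_wandering hα hd hVc ?_ inter_subset_left ?_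
    · exact hVo.measurableSet.inter (((hα _).measurable hCcl.measurableSet).inter
        ((hα _).measurable hCcl.measurableSet.compl))
    · rintro x ⟨-, hx, -⟩ k hk ⟨-, -, hy⟩
      refine hy ?_
      rw [zpow_zpow_apply]
      convert hmaps (k.toNat - 1) _ x hx using 3
      omega
  have hsub : V \ E ⊆ ⋃ n, A n := by
    rintro x ⟨hxV, hxE⟩
    classical
    have hex : ∃ n : ℕ, (α ^ (-(n : ℤ))) x ∉ C := by
      by_contra! hcon
      exact hxE (mem_iInter.2 hcon)
    obtain ⟨N, hN, hmin⟩ : ∃ N : ℕ, (α ^ (-(N : ℤ))) x ∉ C ∧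
        ∀ M < N, ¬ (α ^ (-(M : ℤ))) x ∉ C :=
      ⟨Nat.find hex, Nat.find_spec hex, fun M hM => Nat.find_min hex hM⟩
    obtain _ | N := N
    · exact absurd (by simpa using hVC hxV) hN
    refine mem_iUnion.2 ⟨N, hxV, not_not.1 (hmin N (Nat.lt_succ_self N)), ?_⟩
    have : -((N + 1 : ℕ) : ℤ) = -(N : ℤ) - 1 := by push_cast; ring
    rwa [this] at hN
  refine hf.compactSpace_of_invariant (hC.of_isClosed_subset hEcl hEC) hEcl hinv fun h0 => ?_
  have hV0 : μ V = 0 := by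
    refine measure_mono_null (t := E ∪ V \ E) (fun x hx => ?_)
      (measure_union_null h0 (measure_mono_null hsub (measure_iUnion_null hA0)))
    by_cases hxE : x ∈ E
    · exact Or.inl hxE
    · exact Or.inr ⟨hx, hxE⟩
  exact hVne.ne_empty ((hVo.measure_eq_zero_iff μ).1 hV0)

end Ergodic

theorem mainTheorem2 {G : Type*} [Group G] [TopologicalSpace G] [IsTopologicalGroup G]
    [LocallyCompactSpace G] [TotallyDisconnectedSpace G] [MeasurableSpace G] [BorelSpace G]
    (μ : Measure G) [μ.IsHaarMeasure] (f : G ≃ₜ* G) (hf : IsErgodicFor f μ) :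
    CompactSpace G := by
  let α : MulAut G := f.toMulEquiv
  have hα : ∀ n : ℤ, Continuous (α ^ n) := by
    have hpow : ∀ β : MulAut G, Continuous β → ∀ n : ℕ, Continuous (β ^ n) := by
      intro β hβ n
      induction n with
      | zero => exact continuous_id
      | succ n ih => exact ih.comp hβ
    rintro (n | n)
    · exact hpow α f.continuous_toFun n
    · rw [zpow_negSucc, ← inv_pow]
      exact hpow α⁻¹ f.continuous_invFun (n + 1)
  have hfα : IsErgodicFor α μ := hf
  -- In a discrete group the points have positive measure, and `{1}` is invariant.
  by_cases hd : DiscreteTopology G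
  · refine hfα.compactSpace_of_invariant isCompact_singleton (isClosed_discrete {(1 : G)}) ?_ ?_
    · ext x
      simp
    · rw [Ne, (isOpen_discrete _).measure_eq_zero_iff μ]
      exact singleton_ne_empty _
  obtain ⟨U, hUo, hUc, -⟩ := exists_isOpen_isCompact_subgroup (G := G) univ_mem
  obtain ⟨V, hVo, hVc, hfac⟩ := exists_eq_mul_staySubgroup hα hUo hUc
  have hC : IsCompact ((staySubgroup α V (Ici 0) : Set G) *
      ((homoclinicSubgroup α V).topologicalClosure : Set G)) :=
    (hVc.of_isClosed_subset (isClosed_staySubgroup hα hVc.isClosed)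
      (staySubgroup_le (by simp))).mul (isCompact_closure_homoclinicSubgroup hα hVo hVc)
  refine hfα.compactSpace_of_mapsTo hα hd hVo ⟨1, V.one_mem⟩ hVc hC ?_
    (hfα.subset_of_recurrent hα hd hVo hVc hC.isClosed fun x hx hrec =>
      mem_mul_closure_homoclinicSubgroup hα hVo hVc hfac hx hrec)
  rintro _ ⟨m, hm, l, hl, rfl⟩
  refine ⟨(α ^ (1 : ℤ)) m, (zpow_mem_staySubgroup _).2 fun i hi => hm _ ?_, (α ^ (1 : ℤ)) l,
    zpow_mem_topologicalClosure_homoclinicSubgroup hα 1 hl, by simp⟩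
  simp only [mem_Ici] at *
  omega
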